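/- Let $0\le k\le m$ be integers of the same parity, let $x_1<\dots<x_k$ be real numbers, and let $B:\mathbb R\to\mathbb R$ be a Borel function with sign changes at $x_1,\dots,x_k$ that is nonnegative to the right of $x_k$, in the sense that $B(x)\prod_{j=1}^k(x-x_j)\ge 0$ for all $x\in\mathbb R$ (for $k=0$: $B\ge 0$ on $\mathbb R$). Let $X$ be a real random variable with $E|B(X)X^j|<\infty$ for $0\le j\le m$ and $$\alpha:=\frac1{k!}E\Bigl[B(X)\prod_{j=1}^k(X-x_j)\Bigr]\ne 0 .$$ If $k=0$, assume in addition that the generalized $X$-$B$ biased distribution, that is, the unique law of a random variable $Y$ with $\alpha E[F(Y)]=E[B(X)F(X)]$ for all bounded Borel functions $F$, is not the Dirac measure at $0$. For $m\ge1$ let $\mathcal F^m$ be the set of all $F\in C^{m-1}(\mathbb R)$ with $F^{(m-1)}$ Lipschitz continuous, so that $F^{(m)}$ is defined Lebesgue-almost everywhere (set $F^{(m)}:=0$ where it does not exist), and let $\mathcal F^0$ be the set of all bounded Borel functions on $\mathbb R$. For $F\in\mathcal F^m$ let $$L_F(x):=\sum_{l=1}^k F(x_l)\prod_{r\ne l}\frac{x-x_r}{x_l-x_r}$$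 be the interpolation polynomial of $F$ at $x_1,\dots,x_k$ ($L_F:=0$ if $k=0$). For $k\ge1$ and $j\ge i\ge 0$ let $$a_i^{(j)}:=\sum_{l=1}^k\frac{x_l^{k+j-i-1}}{\prod_{r\ne l}(x_l-x_r)},$$ and define $$R_F(x):=\prod_{j=1}^k(x-x_j)\sum_{i=0}^{m-k-1}\Bigl(\sum_{j=i}^{m-k-1}\frac{F^{(k+j)}(0)\,a_i^{(j)}}{(k+j)!}\Bigr)x^i\quad(k\ge1),\qquad R_F(x):=\sum_{j=0}^{m-1}\frac{F^{(j)}(0)}{j!}x^j\quad(k=0).$$ Finally let $$\beta:=\frac1{m!}E\Bigl[B(X)\Bigl(X^m-\sum_{l=1}^k x_l^m\prod_{r\ne l}\frac{X-x_r}{x_l-x_r}\Bigr)\Bigr],$$ which for $k=0$ is $\frac1{m!}E[B(X)X^m]$. Then: 1. $\beta>0$. 2. There is exactly one probability law on $\mathbb R$ such that, for a random variable $X^{(B,m)}$ with this law, for every $F\in\mathcal F^m$ both of the following expectations exist and $$E\bigl[B(X)\bigl(F(X)-R_F(X)-L_F(X)\bigr)\bigr]=\beta\,E\bigl[F^{(m)}\bigl(X^{(B,m)}\bigr)\bigr].$$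 3. This law is absolutely continuous with respect to Lebesgue measure unless $k=m=0$. 4. For every $F\in\mathcal F^m$, $R_F=0$ if $k=m$, and $R_F$ has degree at most $m-1$ if $k<m$. 5. If $k\ge1$, then for all $j\ge i\ge0$ $$a_i^{(j)}=\sum_{\substack{(\alpha_1,\dots,\alpha_k)\in\mathbb N_0^k\\ \alpha_1+\dots+\alpha_k=j-i}}x_1^{\alpha_1}\cdots x_k^{\alpha_k}.$$ -/

import Mathlib

open MeasureTheory

noncomputable section

namespace BiasTransform

/-- `B` has `k` sign changes at the points `x 0 < ⋯ < x (k-1)` and is nonnegative to the right of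
the last one: `B` is nonnegative on `(x (k-1), ∞)`, nonpositive on the next interval to the left,
and so on with alternating signs. No condition is put on `B` at the points themselves.
For `k = 0` this says that `B` is nonnegative. -/
def HasSignChanges {k : ℕ} (B : ℝ → ℝ) (x : Fin k → ℝ) : Prop :=
  StrictMono x ∧ ∀ y : ℝ, 0 ≤ B y * ∏ j, (y - x j)

/-- The test functions `F` of order `m`: bounded Borel functions for `m = 0`; for `m ≥ 1`, functions
in `C^{m-1}(ℝ)` whose derivative of order `m - 1` is Lipschitz continuous. -/
def IsTestFunction (m : ℕ) (F : ℝ → ℝ) : Prop :=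
  if m = 0 then Measurable F ∧ ∃ C : ℝ, ∀ y, |F y| ≤ C
  else ContDiff ℝ ((m - 1 : ℕ) : WithTop ℕ∞) F ∧
    ∃ K : NNReal, LipschitzWith K (iteratedDeriv (m - 1) F)

/-- The interpolation polynomial `L_F` of `F` at the nodes `x`
(it is `0` when there are no nodes). -/
def LPoly {k : ℕ} (x : Fin k → ℝ) (F : ℝ → ℝ) : Polynomial ℝ :=
  Lagrange.interpolate Finset.univ x (fun l => F (x l))

/-- The coefficient `a_i^{(j)}` (used for `k ≥ 1` and `i ≤ j`). -/
def aCoeff {k : ℕ} (x : Fin k → ℝ) (i j : ℕ) : ℝ :=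
  ∑ l, x l ^ (k + j - i - 1) / ∏ r ∈ Finset.univ.erase l, (x l - x r)

/-- The polynomial `R_F`. -/
def RPoly {k : ℕ} (m : ℕ) (x : Fin k → ℝ) (F : ℝ → ℝ) : Polynomial ℝ :=
  if k = 0 then
    ∑ j ∈ Finset.range m, Polynomial.C (iteratedDeriv j F 0 / (j.factorial : ℝ)) * Polynomial.X ^ j
  else
    (∏ j, (Polynomial.X - Polynomial.C (x j))) *
      ∑ i ∈ Finset.range (m - k),
        Polynomial.C (∑ j ∈ Finset.Ico i (m - k),
          iteratedDeriv (k + j) F 0 * aCoeff x i j / ((k + j).factorial : ℝ)) * Polynomial.X ^ i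

variable {Ω : Type*} [MeasurableSpace Ω]

/-- `α = (1 / k!) E[B(X) ∏_j (X - x_j)]`. -/
def alpha {k : ℕ} (P : Measure Ω) (X : Ω → ℝ) (B : ℝ → ℝ) (x : Fin k → ℝ) : ℝ :=
  1 / (k.factorial : ℝ) * ∫ ω, B (X ω) * ∏ j, (X ω - x j) ∂P

/-- `β = (1 / m!) E[B(X) (X^m - ∑_l x_l^m ∏_{r ≠ l} (X - x_r) / (x_l - x_r))]`; for `k = 0` the sum
is empty and `β = (1 / m!) E[B(X) X^m]`. -/
def beta {k : ℕ} (P : Measure Ω) (X : Ω → ℝ) (B : ℝ → ℝ) (m : ℕ) (x : Fin k → ℝ) : ℝ :=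
  1 / (m.factorial : ℝ) * ∫ ω, B (X ω) * (X ω ^ m -
    ∑ l, x l ^ m * ∏ r ∈ Finset.univ.erase l, ((X ω - x r) / (x l - x r))) ∂P

/-- `μ` is the generalized `X`-`B` biased distribution (with sign changes at `x`):
`α E[F^{(k)}(Y)] = E[B(X) (F(X) - L_F(X))]` for `Y ∼ μ` and all test functions of order `k`. -/
def IsGenBiasedLaw {k : ℕ} (P : Measure Ω) (X : Ω → ℝ) (B : ℝ → ℝ) (x : Fin k → ℝ)
    (μ : Measure ℝ) : Prop :=
  IsProbabilityMeasure μ ∧ ∀ F : ℝ → ℝ, IsTestFunction k F →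
    alpha P X B x * ∫ y, iteratedDeriv k F y ∂μ
      = ∫ ω, B (X ω) * (F (X ω) - (LPoly x F).eval (X ω)) ∂P

/-- `μ` is a law of `X^{(B,m)}`: for all test functions `F` of order `m` both expectations exist and
`E[B(X) (F(X) - R_F(X) - L_F(X))] = β E[F^{(m)}(Y)]` for `Y ∼ μ`. Where the Lipschitz function
`F^{(m-1)}` is not differentiable (a Lebesgue null set), `iteratedDeriv m F` has the value `0`. -/
def IsBiasedLaw {k : ℕ} (P : Measure Ω) (X : Ω → ℝ) (B : ℝ → ℝ) (m : ℕ) (x : Fin k → ℝ)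
    (μ : Measure ℝ) : Prop :=
  IsProbabilityMeasure μ ∧ ∀ F : ℝ → ℝ, IsTestFunction m F →
    Integrable (fun ω => B (X ω) *
      (F (X ω) - (RPoly m x F).eval (X ω) - (LPoly x F).eval (X ω))) P ∧
    Integrable (iteratedDeriv m F) μ ∧
    ∫ ω, B (X ω) * (F (X ω) - (RPoly m x F).eval (X ω) - (LPoly x F).eval (X ω)) ∂P
      = beta P X B m x * ∫ y, iteratedDeriv m F y ∂μ

end BiasTransform

end

namespace BiasTransform

/-! Write g for the m-th derivative of F and I for integration from 0. Taylor's formula gives F = T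
+ I^m g with T of degree below m, and `RPoly_eq` identifies R_F with T - L_T. Hence F - R_F - L_F is
the interpolation error of I^m g at the nodes. It depends on F only through g, and it makes sense
for every bounded Borel g. Let Λ(g) be the expectation of B(X) times this error at X; then Λ(1) = β.

The functional Λ is positive. If g ≥ 0, then I^(m-k) g ≥ 0 because m - k is even, so for k ≥ 1 the
(k-1)-th derivative I^(m-k+1) g of I^m g is increasing. Iterated Rolle
(`interpolate_error_mul_nodal_nonneg`) makes the error c ∏ (y - x_j) with c ≥ 0, and B has the sign
of that product. For k = 0 the error is I^m g ≥ 0 itself. Dominated convergence makes Λ continuous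
under bounded pointwise convergence, so Λ / β is integration against a probability measure
(`exists_isProbabilityMeasure_integral_eq`).

For g = 1 and k ≥ 1 the factor c is positive off the nodes, so β = 0 would force α = 0; for k = 0 it
would make δ_0 the generalized biased law. For m ≥ 1 the integral I^m ignores null sets, which gives
absolute continuity. Every bounded continuous function is an m-th derivative of a test function,
which gives uniqueness. -/

/-! ### Barycentric sums, monomial interpolation errors and R_F. -/

open Polynomial in
/-- Sums of powers against the barycentric weights vanish below the critical exponent. -/
theorem sum_pow_div_prod_eq_zero {ι : Type*} [DecidableEq ι] {s : Finset ι} {v : ι → ℝ}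
    (hv : Set.InjOn v s) {p : ℕ} (hp : p + 1 < s.card) :
    ∑ l ∈ s, v l ^ p / ∏ r ∈ s.erase l, (v l - v r) = 0 := by
  -- The sum is the coefficient of X^(card - 1) in the polynomial interpolating X^p, which is X^p
  -- itself.
  have h := Lagrange.coeff_eq_sum hv (P := (X ^ p : ℝ[X])) (by
    rw [degree_X_pow]; exact_mod_cast (by omega : p < s.card))
  simp only [eval_pow, eval_X] at h
  rw [← h, coeff_X_pow, if_neg (by omega)]

open Polynomial in
/-- The interpolation error of a monomial. -/
theorem X_pow_sub_interpolate {ι : Type*} [DecidableEq ι] {s : Finset ι} {v : ι → ℝ}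
    (hv : Set.InjOn v s) (hs : s.Nonempty) (j : ℕ) :
    (X ^ (s.card + j) : ℝ[X]) - Lagrange.interpolate s v (fun l => v l ^ (s.card + j)) =
      Lagrange.nodal s v * ∑ i ∈ Finset.range (j + 1),
        C (∑ l ∈ s, v l ^ (s.card + j - i - 1) / ∏ r ∈ s.erase l, (v l - v r)) * X ^ i := by
  have hcard : 0 < s.card := hs.card_pos
  set N := s.card + j with hN
  -- The added terms have exponent at most card - 2, so their weighted sums vanish; this opens the
  -- way to a full geometric sum.
  have hrange : ∑ i ∈ Finset.range (j + 1),
      C (∑ l ∈ s, v l ^ (N - i - 1) / ∏ r ∈ s.erase l, (v l - v r)) * (X : ℝ[X]) ^ i =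
      ∑ i ∈ Finset.range N,
      C (∑ l ∈ s, v l ^ (N - i - 1) / ∏ r ∈ s.erase l, (v l - v r)) * (X : ℝ[X]) ^ i := by
    apply Finset.sum_subset
    · intro i hi
      simp only [Finset.mem_range] at hi ⊢
      omega
    · intro i hi hi'
      simp only [Finset.mem_range] at hi hi'
      rw [sum_pow_div_prod_eq_zero hv (by omega)]
      simp
  rw [hrange, Lagrange.interpolate_apply]
  -- Since the basis polynomials sum to 1, X^N can be spread over them. Each X^N - v_l^N is then X -
  -- v_l times a geometric sum, and X - v_l completes the basis polynomial to a multiple of the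
  -- nodal polynomial.
  calc (X ^ N : ℝ[X]) - ∑ l ∈ s, C (v l ^ N) * Lagrange.basis s v l
      = ∑ l ∈ s, (X ^ N - C (v l) ^ N) * Lagrange.basis s v l := by
        simp only [sub_mul, Finset.sum_sub_distrib, ← Finset.mul_sum, Lagrange.sum_basis hv hs,
          mul_one, C_pow]
    _ = ∑ l ∈ s, Lagrange.nodal s v * ∑ i ∈ Finset.range N,
          C (v l ^ (N - i - 1) / ∏ r ∈ s.erase l, (v l - v r)) * X ^ i := by
        refine Finset.sum_congr rfl fun l hl => ?_
        have hb : Lagrange.basis s v l =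
            C ((∏ r ∈ s.erase l, (v l - v r))⁻¹) * Lagrange.nodal (s.erase l) v := by
          simp only [Lagrange.basis, Lagrange.basisDivisor, Finset.prod_mul_distrib,
            Lagrange.nodal, ← map_prod, Finset.prod_inv_distrib]
        rw [← geom_sum₂_mul, hb, Lagrange.nodal_eq_mul_nodal_erase hl, Finset.sum_mul,
          Finset.sum_mul, Finset.mul_sum]
        refine Finset.sum_congr rfl fun i _ => ?_
        rw [div_eq_mul_inv, C_mul, C_pow, Nat.sub_right_comm]
        ring
    _ = _ := by
        rw [← Finset.mul_sum, Finset.sum_comm]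
        simp only [map_sum, Finset.sum_mul]

open Polynomial in
/-- The weighted power sums are the complete homogeneous symmetric polynomials. -/
theorem sum_pow_div_prod_eq_sum_piAntidiag {ι : Type*} [DecidableEq ι] {s : Finset ι} {v : ι → ℝ}
    (hv : Set.InjOn v s) (hs : s.Nonempty) (d : ℕ) :
    ∑ l ∈ s, v l ^ (s.card + d - 1) / ∏ r ∈ s.erase l, (v l - v r) =
      ∑ a ∈ Finset.piAntidiag s d, ∏ l ∈ s, v l ^ a l := by
  induction hs using Finset.Nonempty.cons_induction generalizing d with
  | singleton a =>
    have h : Finset.piAntidiag {a} d = {fun j => if j = a then d else 0} := by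
      ext f
      simp only [Finset.mem_piAntidiag, Finset.sum_singleton, Finset.mem_singleton]
      constructor
      · rintro ⟨rfl, h⟩
        funext j
        split_ifs with hj
        · rw [hj]
        · by_contra h0
          exact hj (h j h0)
      · rintro rfl
        simp
    simp [h]
  | cons a s ha hs ih =>
    rw [Finset.coe_cons, Set.injOn_insert (by simpa using ha)] at hv
    obtain ⟨hv, hva⟩ := hv
    have hne : ∀ i ∈ s, v a ≠ v i := fun i hi h => hva ⟨i, hi, h.symm⟩
    have hN := Lagrange.eval_nodal_not_at_node hne
    -- Evaluating the error for the old nodes at the new node v a gives the recursion h_d(s ∪ {a}) =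
    -- ∑ h_(d-i)(s) v_a^i.
    have key := congrArg (eval (v a)) (X_pow_sub_interpolate hv hs d)
    rw [eval_sub, eval_mul, Lagrange.eval_interpolate_not_at_node _ hne, eval_finsetSum] at key
    simp only [eval_pow, eval_X, eval_mul, eval_C] at key
    have hleft : ∑ l ∈ Finset.cons a s ha, v l ^ ((Finset.cons a s ha).card + d - 1) /
        ∏ r ∈ (Finset.cons a s ha).erase l, (v l - v r) =
        ∑ i ∈ Finset.range (d + 1),
          (∑ l ∈ s, v l ^ (s.card + d - i - 1) / ∏ r ∈ s.erase l, (v l - v r)) * v a ^ i := by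
      apply mul_left_cancel₀ hN
      rw [← key, Finset.sum_cons, Finset.card_cons, Finset.erase_cons, mul_add,
        Lagrange.eval_nodal, show s.card + 1 + d - 1 = s.card + d by omega,
        mul_div_cancel₀ _ (by rwa [Lagrange.eval_nodal] at hN), sub_eq_add_neg, ← mul_neg,
        ← Finset.sum_neg_distrib]
      congr 2
      refine Finset.sum_congr rfl fun l hl => ?_
      have hla : l ≠ a := fun h => ha (h ▸ hl)
      rw [Finset.erase_cons_of_ne _ hla.symm, Finset.prod_cons, Lagrange.nodalWeight,
        Finset.prod_inv_distrib, div_eq_mul_inv, mul_inv, ← neg_sub (v a) (v l), inv_neg]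
      ring
    rw [hleft, Finset.piAntidiag_cons, Finset.sum_disjiUnion,
      Finset.Nat.sum_antidiagonal_eq_sum_range_succ_mk]
    refine Finset.sum_congr rfl fun i hi => ?_
    have hi' : i ≤ d := Nat.lt_succ_iff.mp (Finset.mem_range.mp hi)
    rw [show s.card + d - i - 1 = s.card + (d - i) - 1 by omega, ih hv, Finset.sum_map,
      Finset.sum_mul]
    refine Finset.sum_congr rfl fun f hf => ?_
    have hfa : f a = 0 := by
      by_contra h
      exact ha ((Finset.mem_piAntidiag.mp hf).2 a h)
    rw [Finset.prod_cons, mul_comm]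
    congr 1
    · simp [hfa]
    · refine Finset.prod_congr rfl fun l hl => ?_
      have hla : l ≠ a := fun h => ha (h ▸ hl)
      simp [hla]

open Polynomial in
/-- The polynomial `R_F` is the interpolation error of the Taylor polynomial of `F` at `0`. -/
theorem RPoly_eq {k m : ℕ} (hkm : k ≤ m) {x : Fin k → ℝ} (hx : Function.Injective x)
    (F : ℝ → ℝ) :
    RPoly m x F =
      (∑ j ∈ Finset.range m, C (iteratedDeriv j F 0 / (j.factorial : ℝ)) * X ^ j) -
      LPoly x (fun y => (∑ j ∈ Finset.range m,
        C (iteratedDeriv j F 0 / (j.factorial : ℝ)) * X ^ j : ℝ[X]).eval y) := by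
  rcases Nat.eq_zero_or_pos k with rfl | hk
  · simp [RPoly, LPoly]
  have hinj : Set.InjOn x (Finset.univ : Finset (Fin k)) := hx.injOn
  have hne : (Finset.univ : Finset (Fin k)).Nonempty := ⟨⟨0, hk⟩, Finset.mem_univ _⟩
  have hL : LPoly x (fun y => (∑ j ∈ Finset.range m,
        C (iteratedDeriv j F 0 / (j.factorial : ℝ)) * X ^ j : ℝ[X]).eval y) =
      ∑ j ∈ Finset.range m, C (iteratedDeriv j F 0 / (j.factorial : ℝ)) *
        Lagrange.interpolate Finset.univ x (fun l => x l ^ j) := by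
    rw [LPoly]
    simp only [C_mul', ← map_smul, ← map_sum]
    congr 1
    funext l
    simp [eval_finsetSum]
  rw [hL, ← Finset.sum_sub_distrib]
  simp only [← mul_sub]
  obtain ⟨n, rfl⟩ := Nat.exists_eq_add_of_le hkm
  -- Monomials of degree below k are reproduced by interpolation, so only the degrees k + j
  -- contribute.
  rw [Finset.sum_range_add, Finset.sum_eq_zero, zero_add]
  · rw [RPoly, if_neg hk.ne', Nat.add_sub_cancel_left]
    have hmono : ∀ j, (X ^ (k + j) : ℝ[X]) -
        Lagrange.interpolate Finset.univ x (fun l => x l ^ (k + j)) =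
        Lagrange.nodal Finset.univ x *
          ∑ i ∈ Finset.range (j + 1), C (aCoeff x i j) * X ^ i := by
      simpa [aCoeff] using X_pow_sub_interpolate hinj hne
    simp only [hmono, ← mul_assoc, mul_comm (C _) (Lagrange.nodal _ _)]
    simp only [mul_assoc, ← Finset.mul_sum]
    rw [Lagrange.nodal_eq]
    congr 1
    simp only [map_sum, Finset.sum_mul, Finset.mul_sum]
    rw [Finset.sum_sigma', Finset.sum_sigma']
    refine Finset.sum_bij' (fun p _ => ⟨p.2, p.1⟩) (fun p _ => ⟨p.2, p.1⟩) ?_ ?_ ?_ ?_ ?_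
    · rintro ⟨i, j⟩ h
      simp only [Finset.mem_sigma, Finset.mem_range, Finset.mem_Ico] at h ⊢
      omega
    · rintro ⟨i, j⟩ h
      simp only [Finset.mem_sigma, Finset.mem_range, Finset.mem_Ico] at h ⊢
      omega
    · simp
    · simp
    · rintro ⟨i, j⟩ h
      simp only [← mul_assoc, ← C_mul]
      congr 2
      ring
  · intro j hj
    rw [Finset.mem_range] at hj
    rw [← Lagrange.eq_interpolate_of_eval_eq _ hinj (f := X ^ j), sub_self, mul_zero]
    · rw [degree_X_pow]
      simpa using hj
    · simp

open Polynomial in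
theorem natDegree_RPoly_le {k m : ℕ} (hkm : k < m) (x : Fin k → ℝ) (F : ℝ → ℝ) :
    (RPoly m x F).natDegree ≤ m - 1 := by
  have hsum : ∀ (n : ℕ) (c : ℕ → ℝ),
      (∑ i ∈ Finset.range n, C (c i) * X ^ i : ℝ[X]).natDegree ≤ n - 1 := by
    intro n c
    refine natDegree_sum_le_of_forall_le _ _ fun i hi => ?_
    rw [Finset.mem_range] at hi
    exact (natDegree_C_mul_X_pow_le _ _).trans (by omega)
  unfold RPoly
  split_ifs with hk
  · exact hsum _ _
  · refine natDegree_mul_le.trans ?_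
    have h1 : (∏ j, (X - C (x j)) : ℝ[X]).natDegree = k := by
      rw [← Lagrange.nodal_eq, Lagrange.natDegree_nodal, Finset.card_univ, Fintype.card_fin]
    have h2 := hsum (m - k) (fun i => ∑ j ∈ Finset.Ico i (m - k),
          iteratedDeriv (k + j) F 0 * aCoeff x i j / ((k + j).factorial : ℝ))
    omega

theorem RPoly_self {k : ℕ} (x : Fin k → ℝ) (F : ℝ → ℝ) : RPoly k x F = 0 := by
  unfold RPoly
  split_ifs with hk
  · simp [hk]
  · simp

/-! ### Rolle's theorem and the sign of divided differences. -/

/-- Iterated Rolle theorem: a `C^n` function with `n + 2` distinct zeros has an `n`-th derivative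
with two distinct zeros. -/
theorem exists_two_zeros_iteratedDeriv (n : ℕ) (f : ℝ → ℝ) (hf : ContDiff ℝ n f)
    (z : Fin (n + 2) → ℝ) (hz : StrictMono z) (h0 : ∀ i, f (z i) = 0) :
    ∃ a b, a < b ∧ iteratedDeriv n f a = 0 ∧ iteratedDeriv n f b = 0 := by
  induction n generalizing f with
  | zero => exact ⟨z 0, z 1, hz (by simp), by simpa using h0 0, by simpa using h0 1⟩
  | succ n ih =>
    have hc : ContDiff ℝ ((n : WithTop ℕ∞) + 1) f := by exact_mod_cast hf
    rw [contDiff_succ_iff_deriv] at hc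
    -- The zeros of the derivative interlace those of f, hence are again strictly increasing.
    have hr : ∀ i : Fin (n + 2), ∃ w ∈ Set.Ioo (z i.castSucc) (z i.succ), deriv f w = 0 :=
      fun i => exists_deriv_eq_zero (hz Fin.castSucc_lt_succ) hf.continuous.continuousOn
        (by rw [h0, h0])
    choose w hw hw0 using hr
    simp only [iteratedDeriv_succ']
    refine ih (deriv f) hc.2.2 w ?_ hw0
    rw [Fin.strictMono_iff_lt_succ]
    intro i
    calc w i.castSucc < z i.castSucc.succ := (hw _).2
      _ = z i.succ.castSucc := by rw [Fin.succ_castSucc]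
      _ < w i.succ := (hw _).1

open Polynomial in
theorem iteratedDeriv_eval (p : ℝ[X]) (n : ℕ) :
    iteratedDeriv n (fun y => p.eval y) = fun y => (derivative^[n] p).eval y := by
  induction n generalizing p with
  | zero => simp
  | succ n ih =>
    rw [iteratedDeriv_succ', Function.iterate_succ_apply, ← ih]
    congr 1
    funext y
    exact p.deriv

open Polynomial in
/-- A polynomial of degree at most `n + 1` has an affine derivative of order `n`. -/
theorem eval_iterate_derivative_sub {p : ℝ[X]} {n : ℕ} (hp : p.natDegree ≤ n + 1) (a b : ℝ) :
    (derivative^[n] p).eval b - (derivative^[n] p).eval a =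
      ((n + 1).factorial : ℝ) * p.coeff (n + 1) * (b - a) := by
  have hd : (derivative^[n] p).natDegree ≤ 1 := by
    have := natDegree_iterate_derivative p n
    omega
  have h1 : (derivative^[n] p).coeff 1 = ((n + 1).factorial : ℝ) * p.coeff (n + 1) := by
    rw [coeff_iterate_derivative, nsmul_eq_mul, add_comm 1 n]
    congr 2
    have := Nat.factorial_mul_descFactorial (n := n + 1) (k := n) (by omega)
    simpa using this
  rw [eq_X_add_C_of_natDegree_le_one hd, h1]
  simp
  ring

open Polynomial in
/-- If the leading coefficient of the polynomial interpolating `f` at the `n + 1` points of `s` and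
at `y` is `c`, then the derivative of order `n` of `f` has a chord of slope `(n + 1)! c`. -/
theorem exists_chord_iteratedDeriv {ι : Type*} [DecidableEq ι] {s : Finset ι} {v : ι → ℝ}
    (hv : Set.InjOn v s) {n : ℕ} (hs : s.card = n + 1) {f : ℝ → ℝ} (hf : ContDiff ℝ n f) {y : ℝ}
    (hy : ∀ i ∈ s, y ≠ v i) {c : ℝ}
    (hc : f y - (Lagrange.interpolate s v (fun i => f (v i))).eval y =
      c * (Lagrange.nodal s v).eval y) :
    ∃ a b, a < b ∧ iteratedDeriv n f b - iteratedDeriv n f a =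
      ((n + 1).factorial : ℝ) * c * (b - a) := by
  set L := Lagrange.interpolate s v (fun i => f (v i))
  -- The correction term makes p agree with f at y as well, so f - p has n + 2 zeros; the n-th
  -- derivative of p is affine with slope (n + 1)! c.
  set p : ℝ[X] := L + C c * Lagrange.nodal s v with hp
  have hLdeg : L.natDegree ≤ n := by
    have := Lagrange.degree_interpolate_le (r := fun i => f (v i)) hv
    rw [hs] at this
    exact natDegree_le_of_degree_le this
  have hNdeg : (Lagrange.nodal s v).natDegree = n + 1 := by rw [Lagrange.natDegree_nodal, hs]
  have hpdeg : p.natDegree ≤ n + 1 := by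
    refine (natDegree_add_le _ _).trans (max_le (by omega) ?_)
    exact (natDegree_C_mul_le _ _).trans hNdeg.le
  have hpcoeff : p.coeff (n + 1) = c := by
    rw [hp, coeff_add, coeff_C_mul, coeff_eq_zero_of_natDegree_lt (by omega), ← hNdeg,
      coeff_natDegree, (Lagrange.nodal_monic).leadingCoeff]
    ring
  set S : Finset ℝ := insert y (s.image v)
  have hS : S.card = n + 2 := by
    rw [Finset.card_insert_of_notMem, Finset.card_image_of_injOn hv, hs]
    rw [Finset.mem_image]
    rintro ⟨i, hi, h⟩
    exact hy i hi h.symm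
  have hzero : ∀ t ∈ S, f t - p.eval t = 0 := by
    intro t ht
    rw [Finset.mem_insert, Finset.mem_image] at ht
    rcases ht with rfl | ⟨i, hi, rfl⟩
    · rw [hp, eval_add, eval_mul, eval_C]
      linarith
    · rw [hp, eval_add, eval_mul, Lagrange.eval_nodal_at_node hi,
        Lagrange.eval_interpolate_at_node _ hv hi]
      ring
  have hpc : ContDiff ℝ n (fun t => p.eval t) := by
    simpa using p.contDiff_aeval (n := n) (𝕜 := ℝ)
  obtain ⟨a, b, hab, ha, hb⟩ := exists_two_zeros_iteratedDeriv n (fun t => f t - p.eval t)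
    (hf.sub hpc) (S.orderEmbOfFin hS) (S.orderEmbOfFin hS).strictMono
    (fun i => hzero _ (S.orderEmbOfFin_mem hS i))
  refine ⟨a, b, hab, ?_⟩
  rw [iteratedDeriv_fun_sub hf.contDiffAt hpc.contDiffAt, iteratedDeriv_eval] at ha hb
  have := eval_iterate_derivative_sub hpdeg a b
  rw [hpcoeff] at this
  linarith

open Polynomial in
/-- Divided differences of functions with monotone derivative are nonnegative. -/
theorem interpolate_error_mul_nodal_nonneg {ι : Type*} [DecidableEq ι] {s : Finset ι} {v : ι → ℝ}
    (hv : Set.InjOn v s) {n : ℕ} (hs : s.card = n + 1) {f : ℝ → ℝ} (hf : ContDiff ℝ n f)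
    (hmono : Monotone (iteratedDeriv n f)) (y : ℝ) :
    ∃ c, 0 ≤ c ∧ f y - (Lagrange.interpolate s v (fun i => f (v i))).eval y =
      c * (Lagrange.nodal s v).eval y ∧
      (StrictMono (iteratedDeriv n f) → (∀ i ∈ s, y ≠ v i) → 0 < c) := by
  by_cases hy : ∀ i ∈ s, y ≠ v i
  · have hN := Lagrange.eval_nodal_not_at_node hy
    have hc := (div_mul_cancel₀
      (f y - (Lagrange.interpolate s v (fun i => f (v i))).eval y) hN).symm
    obtain ⟨a, b, hab, h⟩ := exists_chord_iteratedDeriv hv hs hf hy hc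
    have hfac : (0 : ℝ) < ((n + 1).factorial : ℝ) := by exact_mod_cast Nat.factorial_pos _
    refine ⟨_, ?_, hc, fun hstrict _ => ?_⟩
    · by_contra hneg
      have := mul_neg_of_neg_of_pos (mul_neg_of_pos_of_neg hfac (not_le.mp hneg))
        (sub_pos.mpr hab)
      linarith [hmono hab.le]
    · by_contra hneg
      have := mul_nonpos_of_nonpos_of_nonneg
        (mul_nonpos_of_nonneg_of_nonpos hfac.le (not_lt.mp hneg)) (sub_pos.mpr hab).le
      linarith [hstrict hab]
  -- At a node both the error and the nodal polynomial vanish.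
  · refine ⟨0, le_rfl, ?_, fun _ h => absurd h hy⟩
    push Not at hy
    obtain ⟨i, hi, rfl⟩ := hy
    rw [Lagrange.eval_interpolate_at_node _ hv hi]
    ring

/-! ### Iterated primitives. -/

/-- The `n`-fold primitive of `g` based at `0`. -/
noncomputable def iterInt : ℕ → (ℝ → ℝ) → ℝ → ℝ
  | 0, g => g
  | n + 1, g => fun y => ∫ t in (0 : ℝ)..y, iterInt n g t

theorem iterInt_succ (n : ℕ) (g : ℝ → ℝ) (y : ℝ) :
    iterInt (n + 1) g y = ∫ t in (0 : ℝ)..y, iterInt n g t := rfl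

theorem intervalIntegrable_of_abs_le_pow {f : ℝ → ℝ} (hf : Measurable f) {C : ℝ} {n : ℕ}
    (hC : ∀ y, |f y| ≤ C * |y| ^ n) (a b : ℝ) : IntervalIntegrable f volume a b := by
  have hcont : Continuous fun y : ℝ => C * |y| ^ n := by fun_prop
  refine (hcont.intervalIntegrable a b).mono_fun hf.aestronglyMeasurable
    (Filter.Eventually.of_forall fun y => ?_)
  exact (hC y).trans (le_abs_self _)

theorem continuous_primitive_of_abs_le_pow {f : ℝ → ℝ} (hf : Measurable f) {C : ℝ} {n : ℕ}
    (hC : ∀ y, |f y| ≤ C * |y| ^ n) : Continuous fun y => ∫ t in (0 : ℝ)..y, f t :=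
  intervalIntegral.continuous_primitive (fun a b => intervalIntegrable_of_abs_le_pow hf hC a b) 0

/-- Both properties go through one induction: together they give local integrability, hence
continuity of the next primitive. -/
theorem measurable_iterInt_and_abs_le {g : ℝ → ℝ} (hg : Measurable g) {C : ℝ}
    (hC : ∀ y, |g y| ≤ C) (n : ℕ) :
    Measurable (iterInt n g) ∧ ∀ y, |iterInt n g y| ≤ C * |y| ^ n := by
  have hC0 : 0 ≤ C := (abs_nonneg _).trans (hC 0)
  induction n with
  | zero => exact ⟨hg, by simpa [iterInt] using hC⟩
  | succ n ih =>
    refine ⟨(continuous_primitive_of_abs_le_pow ih.1 ih.2).measurable, fun y => ?_⟩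
    have := intervalIntegral.norm_integral_le_of_norm_le_const (a := 0) (b := y)
      (f := iterInt n g) (C := C * |y| ^ n) (fun t ht => by
        refine (ih.2 t).trans ?_
        have hty : |t| ≤ |y| := by
          rcases Set.mem_uIoc.mp ht with h | h
          · rw [abs_of_pos h.1, abs_of_nonneg (h.1.le.trans h.2)]
            exact h.2
          · rw [abs_of_nonpos h.2, abs_of_neg (h.1.trans_le h.2)]
            linarith
        gcongr)
    rw [sub_zero, mul_assoc, ← pow_succ] at this
    exact this

theorem intervalIntegrable_iterInt {g : ℝ → ℝ} (hg : Measurable g) {C : ℝ}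
    (hC : ∀ y, |g y| ≤ C) (n : ℕ) (a b : ℝ) :
    IntervalIntegrable (iterInt n g) volume a b :=
  intervalIntegrable_of_abs_le_pow (measurable_iterInt_and_abs_le hg hC n).1
    (measurable_iterInt_and_abs_le hg hC n).2 a b

theorem continuous_iterInt_succ {g : ℝ → ℝ} (hg : Measurable g) {C : ℝ}
    (hC : ∀ y, |g y| ≤ C) (n : ℕ) : Continuous (iterInt (n + 1) g) :=
  continuous_primitive_of_abs_le_pow (measurable_iterInt_and_abs_le hg hC n).1
    (measurable_iterInt_and_abs_le hg hC n).2

theorem iterInt_const_mul (c : ℝ) (g : ℝ → ℝ) (n : ℕ) (y : ℝ) :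
    iterInt n (fun t => c * g t) y = c * iterInt n g y := by
  induction n generalizing y with
  | zero => rfl
  | succ n ih =>
    simp only [iterInt_succ, ih]
    exact intervalIntegral.integral_const_mul _ _

theorem iterInt_add {g h : ℝ → ℝ} (hg : Measurable g) {C : ℝ} (hC : ∀ y, |g y| ≤ C)
    (hh : Measurable h) {D : ℝ} (hD : ∀ y, |h y| ≤ D) (n : ℕ) (y : ℝ) :
    iterInt n (fun t => g t + h t) y = iterInt n g y + iterInt n h y := by
  induction n generalizing y with
  | zero => rfl
  | succ n ih =>
    simp only [iterInt_succ, ih]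
    exact intervalIntegral.integral_add (intervalIntegrable_iterInt hg hC n 0 y)
      (intervalIntegrable_iterInt hh hD n 0 y)

theorem tendsto_iterInt {g : ℕ → ℝ → ℝ} {h : ℝ → ℝ} (hg : ∀ i, Measurable (g i)) {C : ℝ}
    (hC : ∀ i y, |g i y| ≤ C)
    (hlim : ∀ y, Filter.Tendsto (fun i => g i y) Filter.atTop (nhds (h y))) (n : ℕ) (y : ℝ) :
    Filter.Tendsto (fun i => iterInt n (g i) y) Filter.atTop (nhds (iterInt n h y)) := by
  induction n generalizing y with
  | zero => exact hlim y
  | succ n ih =>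
    have hcont : Continuous fun y : ℝ => C * |y| ^ n := by fun_prop
    refine intervalIntegral.tendsto_integral_filter_of_dominated_convergence
      (fun y => C * |y| ^ n) ?_ ?_ (hcont.intervalIntegrable _ _) ?_
    · exact Filter.Eventually.of_forall fun i =>
        (measurable_iterInt_and_abs_le (hg i) (hC i) n).1.aestronglyMeasurable
    · exact Filter.Eventually.of_forall fun i => Filter.Eventually.of_forall fun t _ =>
        (measurable_iterInt_and_abs_le (hg i) (hC i) n).2 t
    · exact Filter.Eventually.of_forall fun t _ => ih t

theorem iterInt_zero_fun (n : ℕ) : iterInt n (fun _ => (0 : ℝ)) = fun _ => 0 := by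
  induction n with
  | zero => rfl
  | succ n ih =>
    funext y
    rw [iterInt_succ, ih]
    simp

/-- A single integration already forgets null sets. This is the source of absolute continuity for m
≥ 1. -/
theorem iterInt_succ_congr_ae {g h : ℝ → ℝ} (hgh : g =ᵐ[volume] h) (n : ℕ) :
    iterInt (n + 1) g = iterInt (n + 1) h := by
  induction n with
  | zero =>
    funext y
    refine intervalIntegral.integral_congr_ae ?_
    filter_upwards [hgh] with t ht _ using ht
  | succ n ih =>
    funext y
    rw [iterInt_succ, ih, ← iterInt_succ]

/-- To the left of 0 each integration from 0 reverses orientation and so flips the sign once. -/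
theorem iterInt_sign {g : ℝ → ℝ} (hg : ∀ y, 0 ≤ g y) (n : ℕ) :
    (∀ y, 0 ≤ y → 0 ≤ iterInt n g y) ∧ ∀ y, y ≤ 0 → 0 ≤ (-1) ^ n * iterInt n g y := by
  induction n with
  | zero => exact ⟨fun y _ => hg y, fun y _ => by simpa [iterInt] using hg y⟩
  | succ n ih =>
    refine ⟨fun y hy => intervalIntegral.integral_nonneg hy fun t ht => ih.1 t ht.1,
      fun y hy => ?_⟩
    rw [iterInt_succ, intervalIntegral.integral_symm, pow_succ,
      show (-1 : ℝ) ^ n * -1 * -(∫ t in y..0, iterInt n g t) =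
        (-1) ^ n * ∫ t in y..0, iterInt n g t by ring,
      ← intervalIntegral.integral_const_mul]
    exact intervalIntegral.integral_nonneg hy fun t ht => ih.2 t ht.2

theorem iterInt_nonneg {g : ℝ → ℝ} (hg : ∀ y, 0 ≤ g y) {n : ℕ} (hn : Even n) (y : ℝ) :
    0 ≤ iterInt n g y := by
  rcases le_total 0 y with hy | hy
  · exact (iterInt_sign hg n).1 y hy
  · simpa [hn.neg_one_pow] using (iterInt_sign hg n).2 y hy

theorem monotone_iterInt_succ {g : ℝ → ℝ} (hgm : Measurable g) {C : ℝ} (hC : ∀ y, |g y| ≤ C)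
    (hg : ∀ y, 0 ≤ g y) {n : ℕ} (hn : Even n) : Monotone (iterInt (n + 1) g) := by
  intro a b hab
  rw [iterInt_succ, iterInt_succ, ← sub_nonneg, intervalIntegral.integral_interval_sub_left
    (intervalIntegrable_iterInt hgm hC n 0 b) (intervalIntegrable_iterInt hgm hC n 0 a)]
  exact intervalIntegral.integral_nonneg hab fun t _ => iterInt_nonneg hg hn t

theorem hasDerivAt_iterInt_succ {g : ℝ → ℝ} {n : ℕ} (hc : Continuous (iterInt n g)) (y : ℝ) :
    HasDerivAt (iterInt (n + 1) g) (iterInt n g y) y :=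
  intervalIntegral.integral_hasDerivAt_right (hc.intervalIntegrable _ _)
    (hc.stronglyMeasurableAtFilter _ _) hc.continuousAt

/-- The base level n is left free because g need only be measurable: with n ≥ 1 and g bounded,
`iterInt n g` is already continuous. -/
theorem contDiff_iterInt_add {g : ℝ → ℝ} {n : ℕ} (hc : Continuous (iterInt n g)) (j : ℕ) :
    ContDiff ℝ j (iterInt (n + j) g) ∧ iteratedDeriv j (iterInt (n + j) g) = iterInt n g := by
  induction j with
  | zero => exact ⟨contDiff_zero.mpr hc, by simp⟩
  | succ j ih =>
    have hd := hasDerivAt_iterInt_succ (n := n + j) (g := g) ih.1.continuous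
    have hderiv : deriv (iterInt (n + (j + 1)) g) = iterInt (n + j) g :=
      funext fun y => (hd y).deriv
    refine ⟨?_, ?_⟩
    · have : ContDiff ℝ ((j : WithTop ℕ∞) + 1) (iterInt (n + (j + 1)) g) := by
        rw [contDiff_succ_iff_deriv]
        refine ⟨fun y => (hd y).differentiableAt, by simp, ?_⟩
        rw [hderiv]
        exact ih.1
      exact_mod_cast this
    · rw [iteratedDeriv_succ', hderiv, ih.2]

theorem iterInt_one (n : ℕ) (y : ℝ) :
    iterInt n (fun _ => (1 : ℝ)) y = y ^ n / (n.factorial : ℝ) := by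
  induction n generalizing y with
  | zero => simp [iterInt]
  | succ n ih =>
    simp only [iterInt_succ, ih]
    rw [intervalIntegral.integral_div, integral_pow, Nat.factorial_succ]
    have : (n.factorial : ℝ) ≠ 0 := by positivity
    push_cast
    field_simp
    simp

/-! ### Taylor's formula and test functions. -/

/-- Taylor's formula with integral remainder for functions whose last derivative is Lipschitz. -/
theorem sub_taylor_eq_iterInt (n : ℕ) {F : ℝ → ℝ} (hF : ContDiff ℝ n F) {K : NNReal}
    (hK : LipschitzWith K (iteratedDeriv n F)) (y : ℝ) :
    F y - ∑ j ∈ Finset.range (n + 1), iteratedDeriv j F 0 / (j.factorial : ℝ) * y ^ j =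
      iterInt (n + 1) (iteratedDeriv (n + 1) F) y := by
  induction n generalizing F y with
  | zero =>
    rw [iteratedDeriv_zero] at hK
    -- A Lipschitz function is absolutely continuous, so it is the integral of its almost everywhere
    -- derivative.
    have := (hK.lipschitzOnWith (s := Set.uIcc 0 y)).absolutelyContinuousOnInterval
      |>.integral_deriv_eq_sub
    simp [iterInt, this]
  | succ n ih =>
    have hc : ContDiff ℝ ((n : WithTop ℕ∞) + 1) F := by exact_mod_cast hF
    rw [contDiff_succ_iff_deriv] at hc
    have hd := fun t => ih hc.2.2 (by rwa [← iteratedDeriv_succ']) t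
    simp only [← iteratedDeriv_succ'] at hd
    have hint : ∫ t in (0 : ℝ)..y, deriv F t = F y - F 0 :=
      intervalIntegral.integral_deriv_eq_sub (fun t _ => hc.1 t)
        (hc.2.2.continuous.intervalIntegrable _ _)
    rw [iterInt_succ, ← intervalIntegral.integral_congr (fun t _ => hd t),
      intervalIntegral.integral_sub (hc.2.2.continuous.intervalIntegrable _ _)
        (Continuous.intervalIntegrable (by fun_prop) _ _), hint,
      intervalIntegral.integral_finsetSum
        (fun j _ => Continuous.intervalIntegrable (by fun_prop) _ _),
      Finset.sum_range_succ' _ (n + 1)]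
    have : ∀ j : ℕ, ∫ t in (0 : ℝ)..y, iteratedDeriv (j + 1) F 0 / (j.factorial : ℝ) * t ^ j =
        iteratedDeriv (j + 1) F 0 / ((j + 1).factorial : ℝ) * y ^ (j + 1) := by
      intro j
      rw [intervalIntegral.integral_const_mul, integral_pow, Nat.factorial_succ]
      have : (j.factorial : ℝ) ≠ 0 := by positivity
      push_cast
      field_simp
      simp
    simp only [this]
    simp
    ring

open Polynomial in
theorem IsTestFunction.sub_taylor_eq_iterInt {m : ℕ} {F : ℝ → ℝ} (hF : IsTestFunction m F)
    (y : ℝ) :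
    F y - (∑ j ∈ Finset.range m,
      C (iteratedDeriv j F 0 / (j.factorial : ℝ)) * X ^ j : ℝ[X]).eval y =
      iterInt m (iteratedDeriv m F) y := by
  cases m with
  | zero => simp [iterInt]
  | succ n =>
    rw [IsTestFunction, if_neg (Nat.succ_ne_zero n), Nat.add_sub_cancel] at hF
    obtain ⟨hF, K, hK⟩ := hF
    rw [← BiasTransform.sub_taylor_eq_iterInt n hF hK y]
    simp [eval_finsetSum]

theorem IsTestFunction.measurable_iteratedDeriv {m : ℕ} {F : ℝ → ℝ} (hF : IsTestFunction m F) :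
    Measurable (iteratedDeriv m F) := by
  cases m with
  | zero => simpa using hF.1
  | succ n =>
    rw [iteratedDeriv_succ]
    exact measurable_deriv _

theorem IsTestFunction.exists_abs_iteratedDeriv_le {m : ℕ} {F : ℝ → ℝ} (hF : IsTestFunction m F) :
    ∃ C, ∀ y, |iteratedDeriv m F y| ≤ C := by
  cases m with
  | zero => simpa using hF.2
  | succ n =>
    rw [IsTestFunction, if_neg (Nat.succ_ne_zero n), Nat.add_sub_cancel] at hF
    obtain ⟨hF, K, hK⟩ := hF
    refine ⟨K, fun y => ?_⟩
    rw [iteratedDeriv_succ]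
    exact norm_deriv_le_of_lipschitz hK

/-- Supplies enough test functions for uniqueness: their m-th derivatives exhaust the bounded
continuous functions. -/
theorem isTestFunction_iterInt {g : ℝ → ℝ} (hg : Continuous g) {C : ℝ} (hC : ∀ y, |g y| ≤ C)
    (m : ℕ) : IsTestFunction m (iterInt m g) ∧ iteratedDeriv m (iterInt m g) = g := by
  refine ⟨?_, by
    simpa [iterInt] using (contDiff_iterInt_add (n := 0) hg m).2⟩
  unfold IsTestFunction
  split_ifs with hm
  · subst hm
    exact ⟨hg.measurable, C, hC⟩
  · obtain ⟨n, rfl⟩ := Nat.exists_eq_succ_of_ne_zero hm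
    have hc := continuous_iterInt_succ hg.measurable hC 0
    have h := contDiff_iterInt_add hc n
    rw [zero_add, add_comm] at h
    refine ⟨h.1, C.toNNReal, ?_⟩
    rw [Nat.succ_eq_add_one, Nat.add_sub_cancel, h.2]
    refine lipschitzWith_of_nnnorm_deriv_le
      (fun y => (hasDerivAt_iterInt_succ (n := 0) hg y).differentiableAt) fun y => ?_
    rw [(hasDerivAt_iterInt_succ (n := 0) hg y).deriv]
    exact NNReal.le_toNNReal_of_coe_le (hC y)

/-! ### From positive functionals to probability measures. -/

/-- A positive linear functional on bounded measurable functions which is continuous for bounded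
pointwise convergence and normalized is the integral against a probability measure. -/
theorem exists_isProbabilityMeasure_integral_eq {α : Type*} [MeasurableSpace α]
    (Λ : (α → ℝ) → ℝ)
    (hadd : ∀ g h : α → ℝ, Measurable g → (∃ C, ∀ y, |g y| ≤ C) → Measurable h →
      (∃ C, ∀ y, |h y| ≤ C) → Λ (fun y => g y + h y) = Λ g + Λ h)
    (hmul : ∀ (c : ℝ) (g : α → ℝ), Λ (fun y => c * g y) = c * Λ g)
    (hpos : ∀ g : α → ℝ, Measurable g → (∃ C, ∀ y, |g y| ≤ C) → (∀ y, 0 ≤ g y) → 0 ≤ Λ g)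
    (hlim : ∀ (g : ℕ → α → ℝ) (h : α → ℝ) (C : ℝ), (∀ i, Measurable (g i)) →
      (∀ i y, |g i y| ≤ C) →
      (∀ y, Filter.Tendsto (fun i => g i y) Filter.atTop (nhds (h y))) →
      Filter.Tendsto (fun i => Λ (g i)) Filter.atTop (nhds (Λ h)))
    (hone : Λ (fun _ => 1) = 1) :
    ∃ μ : Measure α, IsProbabilityMeasure μ ∧
      (∀ s, MeasurableSet s → μ s = ENNReal.ofReal (Λ (s.indicator fun _ => 1))) ∧
      ∀ g : α → ℝ, Measurable g → (∃ C, ∀ y, |g y| ≤ C) → ∫ y, g y ∂μ = Λ g := by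
  have hzero : Λ (fun _ => 0) = 0 := by simpa using hmul 0 (fun _ => 0)
  have hindm : ∀ s : Set α, MeasurableSet s → Measurable (s.indicator fun _ => (1 : ℝ)) :=
    fun s hs => measurable_const.indicator hs
  have hindb : ∀ (s : Set α) (y : α), |s.indicator (fun _ => (1 : ℝ)) y| ≤ 1 := by
    intro s y
    by_cases hy : y ∈ s <;> simp [hy]
  have hind0 : ∀ s : Set α, MeasurableSet s → 0 ≤ Λ (s.indicator fun _ => 1) := fun s hs =>
    hpos _ (hindm s hs) ⟨1, hindb s⟩ fun y => Set.indicator_nonneg (fun _ _ => zero_le_one) y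
  have hsum : ∀ f : ℕ → Set α, (∀ i, MeasurableSet (f i)) → Pairwise (Function.onFun Disjoint f) →
      HasSum (fun i => Λ ((f i).indicator fun _ => 1)) (Λ ((⋃ i, f i).indicator fun _ => 1)) := by
    intro f hf hd
    rw [hasSum_iff_tendsto_nat_of_nonneg (fun i => hind0 _ (hf i)),
      ← Filter.tendsto_add_atTop_iff_nat 1]
    have hacc : ∀ n, MeasurableSet (Set.accumulate f n) := fun n => by
      rw [Set.accumulate_def]
      exact MeasurableSet.biUnion (Set.to_countable _) fun i _ => hf i
    -- `Set.accumulate f n` includes `f n`, whence the index shift by one; countable additivity then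
    -- follows from continuity of Λ along these increasing unions.
    have hfin : ∀ n, Λ ((Set.accumulate f n).indicator fun _ => 1) =
        ∑ i ∈ Finset.range (n + 1), Λ ((f i).indicator fun _ => 1) := by
      intro n
      induction n with
      | zero => simp [Set.accumulate_zero_nat]
      | succ n ih =>
        rw [Finset.sum_range_succ, ← ih, Set.accumulate_succ, Set.indicator_union_of_disjoint
          (Set.disjoint_accumulate hd (Nat.lt_succ_self n)),
          hadd _ _ (hindm _ (hacc n)) ⟨1, hindb _⟩ (hindm _ (hf _)) ⟨1, hindb _⟩]
    simp only [← hfin]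
    refine hlim _ _ 1 (fun n => hindm _ (hacc n)) (fun n => hindb _) fun y => ?_
    have h := Set.monotone_accumulate.tendsto_indicator (Set.accumulate f)
      (fun _ => (1 : ℝ)) y
    rw [Set.iUnion_accumulate] at h
    exact h.mono_right (pure_le_nhds _)
  set μ : Measure α := Measure.ofMeasurable
    (fun s _ => ENNReal.ofReal (Λ (s.indicator fun _ => 1)))
    (by simp [hzero]) (fun f hf hd => by
      rw [← (hsum f hf hd).tsum_eq,
        ENNReal.ofReal_tsum_of_nonneg (fun i => hind0 _ (hf i)) (hsum f hf hd).summable])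
    with hμdef
  have hμ : ∀ s, MeasurableSet s → μ s = ENNReal.ofReal (Λ (s.indicator fun _ => 1)) :=
    fun s hs => Measure.ofMeasurable_apply s hs
  have hprob : IsProbabilityMeasure μ := ⟨by
    rw [hμ _ MeasurableSet.univ, Set.indicator_univ, hone, ENNReal.ofReal_one]⟩
  have hsimple : ∀ f : SimpleFunc α ℝ, ∫ y, f y ∂μ = Λ f := by
    intro f
    induction f using SimpleFunc.induction with
    | const c hs =>
      rename_i s
      have h : ⇑(SimpleFunc.piecewise s hs (SimpleFunc.const α c) (SimpleFunc.const α 0)) =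
          fun y => c * s.indicator (fun _ => 1) y := by
        funext y
        by_cases hy : y ∈ s <;> simp [hy]
      rw [h, hmul, integral_const_mul, integral_indicator_const _ hs, Measure.real, hμ s hs,
        ENNReal.toReal_ofReal (hind0 s hs)]
      simp
    | add _ hf hg =>
      rename_i f g _
      obtain ⟨C, hC⟩ := f.exists_forall_norm_le
      obtain ⟨D, hD⟩ := g.exists_forall_norm_le
      rw [show ⇑(f + g) = fun y => f y + g y from rfl,
        integral_add (f.integrable_of_isFiniteMeasure) (g.integrable_of_isFiniteMeasure), hf, hg,
        hadd _ _ f.measurable ⟨C, hC⟩ g.measurable ⟨D, hD⟩]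
  refine ⟨μ, hprob, hμ, fun g hg hb => ?_⟩
  obtain ⟨C, hC⟩ := hb
  have hC0 : 0 ≤ C := by
    obtain ⟨y⟩ := nonempty_of_isProbabilityMeasure μ
    exact (abs_nonneg _).trans (hC y)
  have hs := hg.stronglyMeasurable
  -- The identity passes from simple functions to g along uniformly bounded approximations: the
  -- integrals converge by dominated convergence, Λ by `hlim`.
  refine tendsto_nhds_unique ?_ (hlim (fun n => hs.approxBounded C n) g C
    (fun n => SimpleFunc.measurable _) (fun n y => hs.norm_approxBounded_le hC0 n y)
    fun y => hs.tendsto_approxBounded_of_norm_le (hC y))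
  simp only [← hsimple]
  exact tendsto_integral_of_dominated_convergence (fun _ => C)
    (fun n => (SimpleFunc.measurable _).aestronglyMeasurable) (integrable_const C)
    (fun n => Filter.Eventually.of_forall fun y => hs.norm_approxBounded_le hC0 n y)
    (Filter.Eventually.of_forall fun y => hs.tendsto_approxBounded_of_norm_le (hC y))

/-! ### The interpolation error as an operator on g. -/

/-- The interpolation error of the `m`-fold primitive of `g` at the nodes `x`. -/
noncomputable def interpError {k : ℕ} (m : ℕ) (x : Fin k → ℝ) (g : ℝ → ℝ) (y : ℝ) : ℝ :=
  iterInt m g y - (LPoly x (iterInt m g)).eval y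

theorem eval_LPoly {k : ℕ} (x : Fin k → ℝ) (F : ℝ → ℝ) (y : ℝ) :
    (LPoly x F).eval y = ∑ l, F (x l) * (Lagrange.basis Finset.univ x l).eval y := by
  simp [LPoly, Lagrange.interpolate_apply, Polynomial.eval_finsetSum]

theorem LPoly_sub {k : ℕ} (x : Fin k → ℝ) (F G : ℝ → ℝ) :
    LPoly x (fun y => F y - G y) = LPoly x F - LPoly x G := by
  rw [LPoly, LPoly, LPoly, ← map_sub]
  rfl

/-- With T the Taylor polynomial, F - T = I^m F^(m) and R_F = T - L_T; linearity of interpolation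
does the rest. -/
theorem interpError_iteratedDeriv {k m : ℕ} (hkm : k ≤ m) {x : Fin k → ℝ}
    (hx : Function.Injective x) {F : ℝ → ℝ} (hF : IsTestFunction m F) (y : ℝ) :
    interpError m x (iteratedDeriv m F) y =
      F y - (RPoly m x F).eval y - (LPoly x F).eval y := by
  rw [interpError, ← funext fun y => hF.sub_taylor_eq_iterInt y, RPoly_eq hkm hx, LPoly_sub]
  simp only [Polynomial.eval_sub]
  ring

theorem interpError_const_mul {k : ℕ} (m : ℕ) (x : Fin k → ℝ) (c : ℝ) (g : ℝ → ℝ) (y : ℝ) :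
    interpError m x (fun t => c * g t) y = c * interpError m x g y := by
  simp only [interpError, eval_LPoly, iterInt_const_mul, mul_sub, Finset.mul_sum, mul_assoc]

theorem interpError_add {k : ℕ} (m : ℕ) (x : Fin k → ℝ) {g h : ℝ → ℝ} (hg : Measurable g) {C : ℝ}
    (hC : ∀ y, |g y| ≤ C) (hh : Measurable h) {D : ℝ} (hD : ∀ y, |h y| ≤ D) (y : ℝ) :
    interpError m x (fun t => g t + h t) y = interpError m x g y + interpError m x h y := by
  simp only [interpError, eval_LPoly, iterInt_add hg hC hh hD, add_mul, Finset.sum_add_distrib]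
  ring

theorem measurable_interpError {k : ℕ} (m : ℕ) (x : Fin k → ℝ) {g : ℝ → ℝ} (hg : Measurable g)
    {C : ℝ} (hC : ∀ y, |g y| ≤ C) : Measurable (interpError m x g) :=
  (measurable_iterInt_and_abs_le hg hC m).1.sub (Polynomial.continuous _).measurable

theorem tendsto_interpError {k : ℕ} (m : ℕ) (x : Fin k → ℝ) {g : ℕ → ℝ → ℝ} {h : ℝ → ℝ}
    (hg : ∀ i, Measurable (g i)) {C : ℝ} (hC : ∀ i y, |g i y| ≤ C)
    (hlim : ∀ y, Filter.Tendsto (fun i => g i y) Filter.atTop (nhds (h y))) (y : ℝ) :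
    Filter.Tendsto (fun i => interpError m x (g i) y) Filter.atTop
      (nhds (interpError m x h y)) := by
  simp only [interpError, eval_LPoly]
  exact (tendsto_iterInt hg hC hlim m y).sub
    (tendsto_finsetSum _ fun l _ => (tendsto_iterInt hg hC hlim m (x l)).mul_const _)

/-- The growth bound of the interpolation error for functions bounded by `1`. -/
noncomputable def errorBound {k : ℕ} (m : ℕ) (x : Fin k → ℝ) (y : ℝ) : ℝ :=
  |y| ^ m + ∑ l, |x l| ^ m * |(Lagrange.basis Finset.univ x l).eval y|

theorem abs_interpError_le {k : ℕ} (m : ℕ) (x : Fin k → ℝ) {g : ℝ → ℝ} (hg : Measurable g)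
    {C : ℝ} (hC : ∀ y, |g y| ≤ C) (y : ℝ) :
    |interpError m x g y| ≤ C * errorBound m x y := by
  have hb := (measurable_iterInt_and_abs_le hg hC m).2
  rw [interpError, eval_LPoly, errorBound, mul_add, Finset.mul_sum]
  refine (abs_sub _ _).trans (add_le_add (hb y) ?_)
  refine (Finset.abs_sum_le_sum_abs _ _).trans (Finset.sum_le_sum fun l _ => ?_)
  rw [abs_mul, ← mul_assoc]
  exact mul_le_mul_of_nonneg_right (hb _) (abs_nonneg _)

/-- The factor c is a divided difference of I^m g, nonnegative because its (k-1)-th derivative is a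
primitive of I^(m-k) g ≥ 0. This is where the parity of m - k is needed. -/
theorem interpError_eq_mul_prod {k m : ℕ} (hkm : k ≤ m) (hpar : k ≡ m [MOD 2]) {x : Fin k → ℝ}
    (hx : Function.Injective x) {g : ℝ → ℝ} (hg : Measurable g) {C : ℝ} (hC : ∀ y, |g y| ≤ C)
    (hg0 : ∀ y, 0 ≤ g y) (y : ℝ) :
    ∃ c, 0 ≤ c ∧ interpError m x g y = c * ∏ j, (y - x j) := by
  obtain ⟨n, rfl⟩ := Nat.exists_eq_add_of_le hkm
  have hn : Even n := by
    rw [Nat.even_iff]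
    unfold Nat.ModEq at hpar
    omega
  cases k with
  | zero =>
    refine ⟨iterInt (0 + n) g y, iterInt_nonneg hg0 (by simpa using hn) y, ?_⟩
    simp [interpError, LPoly]
  | succ k =>
    -- With k + 1 nodes, Rolle needs only k continuous derivatives, and the k-th one is I^(n+1) g,
    -- continuous even for discontinuous g.
    have hd := contDiff_iterInt_add (continuous_iterInt_succ hg hC n) k
    rw [show n + 1 + k = k + 1 + n by omega] at hd
    have hmono := monotone_iterInt_succ hg hC hg0 hn
    rw [← hd.2] at hmono
    obtain ⟨c, hc, h, -⟩ := interpolate_error_mul_nodal_nonneg (s := Finset.univ) (v := x)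
      hx.injOn (by simp) hd.1 hmono y
    rw [Lagrange.eval_nodal] at h
    exact ⟨c, hc, h⟩

/-- The relevant derivative is now y^(n+1)/(n+1)! with n + 1 odd, which is strictly increasing, so
the divided difference is strictly positive. -/
theorem interpError_one_eq_mul_prod {k m : ℕ} (hk : 0 < k) (hkm : k ≤ m) (hpar : k ≡ m [MOD 2])
    {x : Fin k → ℝ} (hx : Function.Injective x) {y : ℝ} (hy : ∏ j, (y - x j) ≠ 0) :
    ∃ c, 0 < c ∧ interpError m x (fun _ => 1) y = c * ∏ j, (y - x j) := by
  obtain ⟨n, rfl⟩ := Nat.exists_eq_add_of_le hkm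
  have hn : Odd (n + 1) := by
    rw [Nat.odd_iff]
    unfold Nat.ModEq at hpar
    omega
  obtain ⟨k, rfl⟩ := Nat.exists_eq_succ_of_ne_zero hk.ne'
  have hd := contDiff_iterInt_add (continuous_iterInt_succ (g := fun _ => (1 : ℝ)) measurable_const
    (C := 1) (by simp) n) k
  rw [show n + 1 + k = k.succ + n by omega] at hd
  have hmono : StrictMono (iteratedDeriv k (iterInt (k.succ + n) fun _ => (1 : ℝ))) := by
    rw [hd.2]
    intro a b hab
    rw [iterInt_one, iterInt_one]
    exact div_lt_div_of_pos_right (hn.strictMono_pow hab) (by positivity)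
  obtain ⟨c, -, h, hc⟩ := interpolate_error_mul_nodal_nonneg (s := Finset.univ) (v := x)
    hx.injOn (by simp) hd.1 hmono.monotone y
  rw [Lagrange.eval_nodal] at h
  refine ⟨c, hc hmono fun i _ => ?_, h⟩
  exact sub_ne_zero.mp (Finset.prod_ne_zero_iff.mp hy i (Finset.mem_univ i))

theorem interpError_one {k : ℕ} (m : ℕ) (x : Fin k → ℝ) (y : ℝ) :
    interpError m x (fun _ => 1) y = 1 / (m.factorial : ℝ) * (y ^ m -
      ∑ l, x l ^ m * ∏ r ∈ Finset.univ.erase l, ((y - x r) / (x l - x r))) := by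
  have hb : ∀ l, (Lagrange.basis Finset.univ x l).eval y =
      ∏ r ∈ Finset.univ.erase l, ((y - x r) / (x l - x r)) := by
    intro l
    rw [Lagrange.basis, Polynomial.eval_prod]
    refine Finset.prod_congr rfl fun r _ => ?_
    simp [Lagrange.basisDivisor]
    ring
  simp only [interpError, eval_LPoly, iterInt_one, hb, mul_sub, Finset.mul_sum]
  congr 1
  · ring
  · exact Finset.sum_congr rfl fun l _ => by ring

/-! ### The expected interpolation error. -/

/-- The expected interpolation error `E[B(X) (I^m g - L_{I^m g})(X)]`. -/
noncomputable def errorFunctional {k : ℕ} {Ω : Type*} [MeasurableSpace Ω] (P : Measure Ω)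
    (X : Ω → ℝ) (B : ℝ → ℝ) (m : ℕ) (x : Fin k → ℝ) (g : ℝ → ℝ) : ℝ :=
  ∫ ω, B (X ω) * interpError m x g (X ω) ∂P

theorem errorFunctional_one {k : ℕ} {Ω : Type*} [MeasurableSpace Ω] (P : Measure Ω)
    (X : Ω → ℝ) (B : ℝ → ℝ) (m : ℕ) (x : Fin k → ℝ) :
    errorFunctional P X B m x (fun _ => 1) = beta P X B m x := by
  simp only [errorFunctional, interpError_one, beta, mul_left_comm (B _)]
  exact integral_const_mul _ _

theorem integrable_mul_eval {Ω : Type*} [MeasurableSpace Ω] {P : Measure Ω} {X : Ω → ℝ}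
    {B : ℝ → ℝ} {m : ℕ} (hmom : ∀ j ≤ m, Integrable (fun ω => B (X ω) * X ω ^ j) P)
    {p : Polynomial ℝ} (hp : p.natDegree ≤ m) :
    Integrable (fun ω => B (X ω) * p.eval (X ω)) P := by
  simp only [Polynomial.eval_eq_sum_range' (Nat.lt_succ_of_le hp), Finset.mul_sum,
    mul_left_comm (B _)]
  exact integrable_finsetSum _ fun j hj =>
    (hmom j (Nat.lt_succ_iff.mp (Finset.mem_range.mp hj))).const_mul _

theorem integrable_mul_errorBound {k : ℕ} {Ω : Type*} [MeasurableSpace Ω] {P : Measure Ω}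
    {X : Ω → ℝ} {B : ℝ → ℝ} {m : ℕ} (hkm : k ≤ m) {x : Fin k → ℝ} (hx : Function.Injective x)
    (hmom : ∀ j ≤ m, Integrable (fun ω => B (X ω) * X ω ^ j) P) :
    Integrable (fun ω => |B (X ω)| * errorBound m x (X ω)) P := by
  simp only [errorBound, mul_add, Finset.mul_sum, mul_left_comm |B _|]
  refine Integrable.add ?_ (integrable_finsetSum _ fun l _ => Integrable.const_mul ?_ _)
  · simpa only [abs_mul, abs_pow] using (hmom m le_rfl).abs
  -- A basis polynomial has degree k - 1 ≤ m, so the moment assumption covers it.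
  · have hdeg : (Lagrange.basis Finset.univ x l).natDegree ≤ m := by
      rw [Lagrange.natDegree_basis hx.injOn (Finset.mem_univ l), Finset.card_univ,
        Fintype.card_fin]
      omega
    simpa only [abs_mul] using (integrable_mul_eval hmom hdeg).abs

section

variable {k m : ℕ} {Ω : Type*} [MeasurableSpace Ω] {P : Measure Ω} {X : Ω → ℝ} {B : ℝ → ℝ}
  {x : Fin k → ℝ}

theorem integrable_mul_interpError (hX : Measurable X) (hB : Measurable B) (hkm : k ≤ m)
    (hx : Function.Injective x) (hmom : ∀ j ≤ m, Integrable (fun ω => B (X ω) * X ω ^ j) P)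
    {g : ℝ → ℝ} (hg : Measurable g) {C : ℝ} (hC : ∀ y, |g y| ≤ C) :
    Integrable (fun ω => B (X ω) * interpError m x g (X ω)) P := by
  refine ((integrable_mul_errorBound hkm hx hmom).const_mul C).mono'
    ((hB.comp hX).mul ((measurable_interpError m x hg hC).comp hX)).aestronglyMeasurable
    (Filter.Eventually.of_forall fun ω => ?_)
  rw [Real.norm_eq_abs, abs_mul, mul_left_comm]
  exact mul_le_mul_of_nonneg_left (abs_interpError_le m x hg hC _) (abs_nonneg _)

theorem tendsto_errorFunctional (hX : Measurable X) (hB : Measurable B) (hkm : k ≤ m)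
    (hx : Function.Injective x) (hmom : ∀ j ≤ m, Integrable (fun ω => B (X ω) * X ω ^ j) P)
    {g : ℕ → ℝ → ℝ} {h : ℝ → ℝ} (hg : ∀ i, Measurable (g i)) {C : ℝ} (hC : ∀ i y, |g i y| ≤ C)
    (hlim : ∀ y, Filter.Tendsto (fun i => g i y) Filter.atTop (nhds (h y))) :
    Filter.Tendsto (fun i => errorFunctional P X B m x (g i)) Filter.atTop
      (nhds (errorFunctional P X B m x h)) := by
  refine tendsto_integral_of_dominated_convergence
    (fun ω => C * (|B (X ω)| * errorBound m x (X ω)))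
    (fun i => (integrable_mul_interpError hX hB hkm hx hmom (hg i) (hC i)).aestronglyMeasurable)
    ((integrable_mul_errorBound hkm hx hmom).const_mul C)
    (fun i => Filter.Eventually.of_forall fun ω => ?_)
    (Filter.Eventually.of_forall fun ω => (tendsto_interpError m x hg hC hlim _).const_mul _)
  rw [Real.norm_eq_abs, abs_mul, mul_left_comm]
  exact mul_le_mul_of_nonneg_left (abs_interpError_le m x (hg i) (hC i) _) (abs_nonneg _)

theorem mul_interpError_nonneg (hkm : k ≤ m) (hpar : k ≡ m [MOD 2]) (hsign : HasSignChanges B x)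
    {g : ℝ → ℝ} (hg : Measurable g) {C : ℝ} (hC : ∀ y, |g y| ≤ C) (hg0 : ∀ y, 0 ≤ g y) (y : ℝ) :
    0 ≤ B y * interpError m x g y := by
  obtain ⟨c, hc, h⟩ := interpError_eq_mul_prod hkm hpar hsign.1.injective hg hC hg0 y
  rw [h, mul_left_comm]
  exact mul_nonneg hc (hsign.2 y)

theorem alpha_eq_zero_of_ae (h : ∀ᵐ ω ∂P, B (X ω) * ∏ j, (X ω - x j) = 0) :
    alpha P X B x = 0 := by
  rw [alpha, integral_congr_ae h]
  simp

/-- If `B(X) = 0` almost surely on `X ≠ 0`, then the generalized biased law without sign changes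
is the Dirac measure at `0`. -/
theorem isGenBiasedLaw_dirac_zero {x : Fin 0 → ℝ}
    (h : ∀ᵐ ω ∂P, X ω ≠ 0 → B (X ω) = 0) : IsGenBiasedLaw P X B x (Measure.dirac 0) := by
  refine ⟨inferInstance, fun F _ => ?_⟩
  have h1 : ∫ ω, B (X ω) * (F (X ω) - (LPoly x F).eval (X ω)) ∂P =
      ∫ ω, B (X ω) * F 0 ∂P := by
    refine integral_congr_ae ?_
    filter_upwards [h] with ω hω
    by_cases h0 : X ω = 0
    · simp [h0, LPoly]
    · simp [hω h0]
  rw [h1, integral_mul_const]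
  simp [alpha]

/-! ### Positivity of β, existence and uniqueness of the law. -/

/-- As the integral of a nonnegative function, β can vanish only if B(X) times the error of g = 1 is
almost surely 0. The error is nonzero off the nodes for k ≥ 1, and off 0 for k = 0, so this
contradicts `hα` or `hδ`. -/
theorem beta_pos (hX : Measurable X) (hB : Measurable B) (hkm : k ≤ m) (hpar : k ≡ m [MOD 2])
    (hsign : HasSignChanges B x)
    (hmom : ∀ j ≤ m, Integrable (fun ω => B (X ω) * X ω ^ j) P)
    (hα : alpha P X B x ≠ 0)
    (hδ : k = 0 → ¬ IsGenBiasedLaw P X B x (Measure.dirac 0)) :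
    0 < beta P X B m x := by
  have hnn : ∀ y, 0 ≤ B y * interpError m x (fun _ => 1) y :=
    mul_interpError_nonneg hkm hpar hsign measurable_const (C := 1) (by simp) (by simp)
  rw [← errorFunctional_one]
  refine lt_of_le_of_ne (integral_nonneg fun ω => hnn _) fun h0 => ?_
  have hae := (integral_eq_zero_iff_of_nonneg (fun ω => hnn (X ω))
    (integrable_mul_interpError hX hB hkm hsign.1.injective hmom measurable_const
      (C := 1) (by simp))).mp h0.symm
  rcases Nat.eq_zero_or_pos k with rfl | hk
  · refine hδ rfl (isGenBiasedLaw_dirac_zero ?_)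
    filter_upwards [hae] with ω hω hne
    have h1 : B (X ω) * interpError m x (fun _ => 1) (X ω) = 0 := hω
    rw [interpError_one] at h1
    have : (m.factorial : ℝ) ≠ 0 := by positivity
    simpa [hne, this] using h1
  · refine hα (alpha_eq_zero_of_ae ?_)
    filter_upwards [hae] with ω hω
    by_cases hp : ∏ j, (X ω - x j) = 0
    · rw [hp, mul_zero]
    · obtain ⟨c, hc, h⟩ := interpError_one_eq_mul_prod hk hkm hpar hsign.1.injective hp
      have h1 : B (X ω) * interpError m x (fun _ => 1) (X ω) = 0 := hω
      rw [h, mul_left_comm] at h1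
      exact (mul_eq_zero.mp h1).resolve_left hc.ne'

/-- Existence of the biased law, together with its absolute continuity. -/
theorem exists_isBiasedLaw (hX : Measurable X) (hB : Measurable B) (hkm : k ≤ m)
    (hpar : k ≡ m [MOD 2]) (hsign : HasSignChanges B x)
    (hmom : ∀ j ≤ m, Integrable (fun ω => B (X ω) * X ω ^ j) P)
    (hβ : 0 < beta P X B m x) :
    ∃ μ : Measure ℝ, IsBiasedLaw P X B m x μ ∧ (m ≠ 0 → μ.AbsolutelyContinuous volume) := by
  have hx := hsign.1.injective
  obtain ⟨μ, hμ, hset, hint⟩ := exists_isProbabilityMeasure_integral_eq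
    (fun g => errorFunctional P X B m x g / beta P X B m x)
    (by
      rintro g h hg ⟨C, hC⟩ hh ⟨D, hD⟩
      simp only [errorFunctional, interpError_add m x hg hC hh hD, mul_add]
      rw [integral_add (integrable_mul_interpError hX hB hkm hx hmom hg hC)
        (integrable_mul_interpError hX hB hkm hx hmom hh hD), add_div])
    (by
      intro c g
      simp only [errorFunctional, interpError_const_mul, mul_left_comm (B _)]
      rw [integral_const_mul, mul_div_assoc])
    (by
      rintro g hg ⟨C, hC⟩ hg0
      exact div_nonneg (integral_nonneg fun ω =>
        mul_interpError_nonneg hkm hpar hsign hg hC hg0 _) hβ.le)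
    (by
      intro g h C hg hC hlim
      exact (tendsto_errorFunctional hX hB hkm hx hmom hg hC hlim).div_const _)
    (by rw [errorFunctional_one, div_self hβ.ne'])
  refine ⟨μ, ⟨hμ, fun F hF => ?_⟩, fun hm s hs => ?_⟩
  · obtain ⟨C, hC⟩ := hF.exists_abs_iteratedDeriv_le
    have hmeas := hF.measurable_iteratedDeriv
    have hi := integrable_mul_interpError hX hB hkm hx hmom hmeas hC
    simp only [interpError_iteratedDeriv hkm hx hF] at hi
    refine ⟨hi, Integrable.of_bound hmeas.aestronglyMeasurable C
      (Filter.Eventually.of_forall hC), ?_⟩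
    rw [hint _ hmeas ⟨C, hC⟩, mul_div_cancel₀ _ hβ.ne', errorFunctional]
    simp only [interpError_iteratedDeriv hkm hx hF]
  · obtain ⟨t, hst, ht, ht0⟩ := exists_measurable_superset_of_null hs
    -- The measure of t is computed from the primitives of its indicator, which vanish because t is
    -- Lebesgue null.
    refine measure_mono_null hst ?_
    obtain ⟨n, rfl⟩ := Nat.exists_eq_succ_of_ne_zero hm
    have hae : (t.indicator fun _ => (1 : ℝ)) =ᵐ[volume] fun _ => 0 :=
      indicator_meas_zero ht0
    rw [hset t ht]
    simp [errorFunctional, interpError, iterInt_succ_congr_ae hae, iterInt_zero_fun, eval_LPoly]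

/-- Testing with the m-fold primitive of a bounded continuous f recovers the integral of f, as β ≠
0; such integrals determine a finite measure. -/
theorem IsBiasedLaw.unique (hβ : 0 < beta P X B m x) {μ ν : Measure ℝ}
    (hμ : IsBiasedLaw P X B m x μ) (hν : IsBiasedLaw P X B m x ν) : ν = μ := by
  have := hμ.1
  have := hν.1
  refine ext_of_forall_integral_eq_of_IsFiniteMeasure fun f => ?_
  obtain ⟨hF, hd⟩ := isTestFunction_iterInt f.continuous (fun y => f.norm_coe_le_norm y) m
  have h1 := (hμ.2 _ hF).2.2
  have h2 := (hν.2 _ hF).2.2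
  rw [hd] at h1 h2
  exact mul_left_cancel₀ hβ.ne' (h2.symm.trans h1)

end

end BiasTransform

theorem mainTheorem2 {Ω : Type*} [MeasurableSpace Ω] (P : MeasureTheory.Measure Ω)
    [MeasureTheory.IsProbabilityMeasure P]
    (X : Ω → ℝ) (hX : Measurable X) (B : ℝ → ℝ) (hB : Measurable B)
    (k m : ℕ) (hkm : k ≤ m) (hpar : k ≡ m [MOD 2])
    (x : Fin k → ℝ) (hsign : BiasTransform.HasSignChanges B x)
    (hmom : ∀ j ≤ m, MeasureTheory.Integrable (fun ω => B (X ω) * X ω ^ j) P)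
    (hα : BiasTransform.alpha P X B x ≠ 0)
    (hδ : k = 0 → ¬ BiasTransform.IsGenBiasedLaw P X B x (MeasureTheory.Measure.dirac 0)) :
    0 < BiasTransform.beta P X B m x ∧
    (∃ μ : MeasureTheory.Measure ℝ, BiasTransform.IsBiasedLaw P X B m x μ ∧
      (∀ ν : MeasureTheory.Measure ℝ, BiasTransform.IsBiasedLaw P X B m x ν → ν = μ) ∧
      (¬ (k = 0 ∧ m = 0) → μ.AbsolutelyContinuous MeasureTheory.volume)) ∧
    (∀ F : ℝ → ℝ, BiasTransform.IsTestFunction m F →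
      (k = m → BiasTransform.RPoly m x F = 0) ∧
      (k < m → (BiasTransform.RPoly m x F).natDegree ≤ m - 1)) ∧
    (1 ≤ k → ∀ i j : ℕ, i ≤ j →
      BiasTransform.aCoeff x i j
        = ∑ a ∈ Finset.piAntidiag (Finset.univ : Finset (Fin k)) (j - i), ∏ l, x l ^ a l) := by
  have hx := hsign.1.injective
  have hβ := BiasTransform.beta_pos hX hB hkm hpar hsign hmom hα hδ
  obtain ⟨μ, hμ, hac⟩ := BiasTransform.exists_isBiasedLaw hX hB hkm hpar hsign hmom hβ
  -- The excluded case k = m = 0 is the same as m = 0, since k ≤ m.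
  refine ⟨hβ, ⟨μ, hμ, fun ν hν => hμ.unique hβ hν, fun h => hac fun hm => h ⟨by omega, hm⟩⟩,
    fun F _ => ⟨fun h => ?_, fun h => BiasTransform.natDegree_RPoly_le h x F⟩,
    fun hk i j hij => ?_⟩
  · subst h
    exact BiasTransform.RPoly_self x F
  · have hne : (Finset.univ : Finset (Fin k)).Nonempty := ⟨⟨0, hk⟩, Finset.mem_univ _⟩
    rw [← BiasTransform.sum_pow_div_prod_eq_sum_piAntidiag hx.injOn hne, Finset.card_univ,
      Fintype.card_fin, ← Nat.add_sub_assoc hij, BiasTransform.aCoeff]
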